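/- Let $r\in\mathbb{N}$ and let $L\subseteq[0,\infty)^r$ be an additive semigroup with $0\in L$. Let $w\colon L\to(0,\infty)$ be an admissible weight function, i.e. $w(0)=1$, $w(\lambda'+\lambda'')\le w(\lambda')\,w(\lambda'')$ for all $\lambda',\lambda''\in L$, and, for every $\lambda\in L$, $w(\lambda)\ge 1$ and $\lim_{k\to\infty}\sqrt[k]{w(k\lambda)}=1$. Let $\mathscr{A}_w(L)$ be the set of all functions $a\colon L\to\mathbb{C}$ with $\sum_{\lambda\in L}|a(\lambda)|\,w(\lambda)<\infty$. Let $\mathbb{H}=\{z\in\mathbb{C}:\operatorname{Re}z>0\}$, and for $a\in\mathscr{A}_w(L)$ and $s\in\overline{\mathbb{H}}^{\,r}$ put $$\widetilde{a}(s)=\sum_{\lambda\in L}a(\lambda)\,e^{-(\lambda_1s_1+\cdots+\lambda_rs_r)}.$$ Let $f$ be a holomorphic function on a region (non-empty connected open set) $G\subseteq\mathbb{C}$, and let $a\in\mathscr{A}_w(L)$ satisfy $\overline{\widetilde{a}(\mathbb{H}^r)}\subseteq G$. Then there exists $c\in\mathscr{A}_w(L)$ such that $f\circ\widetilde{a}=\widetilde{c}$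 on $\overline{\mathbb{H}}^{\,r}$. -/

import Mathlib

open Filter Topology

/-- A weight function `w : M → (0, ∞)` on an additive monoid: `w 0 = 1` and `w` is
submultiplicative. -/
structure IsWeight {M : Type*} [AddCommMonoid M] (w : M → ℝ) : Prop where
  pos : ∀ x, 0 < w x
  map_zero : w 0 = 1
  map_add_le : ∀ x y, w (x + y) ≤ w x * w y

/-- The class `𝒲(M)` of admissible weights: `w ≥ 1`, and the `k`-th roots of `w (k • x)` tend
to `1` as `k → ∞`, for every `x`. -/
structure IsAdmissibleWeight {M : Type*} [AddCommMonoid M] (w : M → ℝ) : Prop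
    extends IsWeight w where
  one_le : ∀ x, 1 ≤ w x
  tendsto_root : ∀ x, Tendsto (fun k : ℕ => (w (k • x)) ^ (1 / (k : ℝ))) atTop (𝓝 1)

/-- The underlying set of the weighted algebra `𝒜_w(M)`: the functions `a : M → ℂ` with
`∑ x, |a x| * w x < ∞`. -/
def weightedAlgebra {M : Type*} (w : M → ℝ) : Set (M → ℂ) :=
  {a | Summable fun x => ‖a x‖ * w x}

/-- `ℍ^r`, where `ℍ` is the open right half plane. -/
def rightHalfSpace (r : ℕ) : Set (Fin r → ℂ) :=
  {s | ∀ i, 0 < (s i).re}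

/-- The `r`-th power of the closed right half plane. -/
def closedRightHalfSpace (r : ℕ) : Set (Fin r → ℂ) :=
  {s | ∀ i, 0 ≤ (s i).re}

/-- The `r`-dimensional Dirichlet series `∑ x ∈ L, a x * exp (-(x₁ s₁ + ⋯ + x_r s_r))`.
It converges absolutely on the closed right half space as soon as `a` is absolutely summable
and `L` consists of vectors with nonnegative coordinates. -/
noncomputable def dirichletSeries {r : ℕ} {L : AddSubmonoid (Fin r → ℝ)} (a : L → ℂ)
    (s : Fin r → ℂ) : ℂ :=
  ∑' x : L, a x * Complex.exp (-∑ i, ((x : Fin r → ℝ) i : ℂ) * s i)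

/-!
Let `A` be the Banach algebra of weighted summable functions on `L` under convolution, built here as
the completion of the monoid algebra `ℂ[L]` in the weighted `ℓ¹` norm. Evaluation of Dirichlet series
at a point of the closed right half space is a character of `A`. So it suffices to apply `f` to `a` by
the holomorphic functional calculus, and for this `G` has to contain the spectrum of `a`.

*Spectrum* (`spectrum_ofCoeffs_subset`): it is contained in the closure of `ã(ℍ^r)`. Since the weight
is admissible, the characters of `A` are the homomorphisms `χ` from `L` to the closed unit disc; in
general they are far from being limits of evaluations on `ℍ^r`, and they may have zeros. They do,
however, satisfy a maximum principle (`norm_lift_le_of_norm_boundary_le`): if a Dirichlet polynomial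
`p` is bounded by `C` on `i ℝ^r`, then `|χ(p)| ≤ C`. Indeed `|χ(p)| ^ k = |χ(p ^ k)|` is at most the
`ℓ¹` norm of the coefficients of `p ^ k`, which exceeds the `ℓ²` norm by a factor polynomial in `k`,
and the `ℓ²` norm is at most `C ^ k` by Bessel's inequality. If now `|ã - z| ≥ δ` on `ℍ^r`, the
translates `b_σ = ã(· + (σ, …, σ)) - z` are considered for `σ > 0`. When `b_σ` is invertible, the maximum
principle for `1 / b_σ` gives `|χ(b_σ)| ≥ δ` for all `χ`; conversely this bound implies
invertibility by Gelfand theory. Invertibility is an open condition and the bound a closed one, and for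
large `σ` the element `b_σ` is close to a nonzero constant; by connectedness of `(0, ∞)` the bound
holds for all `σ > 0`, hence for `σ = 0`.

*Functional calculus* (`exists_forall_character_eq_comp`): instead of a contour, a smooth cutoff `φ`
equal to `1` near the spectrum is used, and `f(a)` is a multiple of the area integral of
`∂φ/∂z̄ (z) f(z) (z - a)⁻¹`. That characters take the expected value on it is the Cauchy–Pompeiu formula
`integral_dbar_cutoff_mul`.
-/

/-! ### A holomorphic functional calculus -/

/-- Twice the Wirtinger derivative `∂g/∂z̄`. -/
noncomputable def dbar (g : ℂ → ℂ) (z : ℂ) : ℂ :=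
  fderiv ℝ g z 1 + Complex.I * fderiv ℝ g z Complex.I

lemma Filter.EventuallyEq.dbar_eq {g h : ℂ → ℂ} {z : ℂ} (H : g =ᶠ[𝓝 z] h) :
    dbar g z = dbar h z := by
  simp [dbar, H.fderiv_eq]

lemma dbar_mul {g h : ℂ → ℂ} {z : ℂ} (hg : DifferentiableAt ℝ g z)
    (hh : DifferentiableAt ℝ h z) :
    dbar (fun x => g x * h x) z = dbar g z * h z + g z * dbar h z := by
  simp only [dbar, fderiv_fun_mul hg hh, add_apply,
    smul_apply, smul_eq_mul]
  ring

lemma dbar_sub {g h : ℂ → ℂ} {z : ℂ} (hg : DifferentiableAt ℝ g z)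
    (hh : DifferentiableAt ℝ h z) :
    dbar (fun x => g x - h x) z = dbar g z - dbar h z := by
  simp only [dbar, fderiv_fun_sub hg hh, sub_apply]
  ring

lemma dbar_const (c z : ℂ) : dbar (fun _ => c) z = 0 := by
  simp [dbar]

lemma DifferentiableAt.dbar_eq_zero {g : ℂ → ℂ} {z : ℂ} (hg : DifferentiableAt ℂ g z) :
    dbar g z = 0 := by
  have h1 := hg.fderiv_restrictScalars ℝ
  have h2 : fderiv ℂ g z Complex.I = Complex.I * fderiv ℂ g z 1 := by
    simp [← smul_eq_mul]
  simp only [dbar, h1, ContinuousLinearMap.coe_restrictScalars', h2, ← mul_assoc,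
    Complex.I_mul_I]
  ring

lemma dbar_comp_sub (g : ℂ → ℂ) (a z : ℂ) : dbar (fun x => g (x - a)) z = dbar g (z - a) := by
  simp [dbar, fderiv_comp_sub]

lemma ContDiff.continuous_dbar {g : ℂ → ℂ} (hg : ContDiff ℝ 1 g) : Continuous (dbar g) := by
  have := hg.continuous_fderiv one_ne_zero
  unfold dbar
  fun_prop

lemma dbar_eq_zero_of_notMem_tsupport {g : ℂ → ℂ} {z : ℂ} (hz : z ∉ tsupport g) :
    dbar g z = 0 := by
  have : g =ᶠ[𝓝 z] fun _ => 0 := notMem_tsupport_iff_eventuallyEq.1 hz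
  rw [this.dbar_eq, dbar_const]

lemma HasCompactSupport.dbar {g : ℂ → ℂ} (hg : HasCompactSupport g) :
    HasCompactSupport (dbar g) :=
  HasCompactSupport.intro hg fun _ hz => dbar_eq_zero_of_notMem_tsupport hz

lemma integral_fderiv_apply_eq_zero {g : ℂ → ℂ} (hg : ContDiff ℝ 1 g)
    (hc : HasCompactSupport g) (v : ℂ) : ∫ z, fderiv ℝ g z v = 0 := by
  have h1 : MeasureTheory.Integrable (fun z => fderiv ℝ g z v) :=
    ((hg.continuous_fderiv one_ne_zero).clm_apply continuous_const).integrable_of_hasCompactSupport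
      (hc.fderiv_apply (𝕜 := ℝ) v)
  have := integral_mul_fderiv_eq_neg_fderiv_mul_of_integrable
    (μ := MeasureTheory.volume) (f := fun _ : ℂ => (1 : ℂ)) (g := g) (v := v)
    (by simp) (by simpa using h1)
    (by simpa using hg.continuous.integrable_of_hasCompactSupport hc)
    (fun x _ => differentiableAt_const _) (fun x _ => hg.differentiable one_ne_zero x)
  simpa using this

lemma integral_dbar_eq_zero {g : ℂ → ℂ} (hg : ContDiff ℝ 1 g) (hc : HasCompactSupport g) :
    ∫ z, dbar g z = 0 := by
  have h1 (v : ℂ) : MeasureTheory.Integrable (fun z => fderiv ℝ g z v) :=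
    ((hg.continuous_fderiv one_ne_zero).clm_apply continuous_const).integrable_of_hasCompactSupport
      (hc.fderiv_apply (𝕜 := ℝ) v)
  unfold dbar
  rw [MeasureTheory.integral_add (h1 1) ((h1 _).const_mul _), MeasureTheory.integral_const_mul,
    integral_fderiv_apply_eq_zero hg hc, integral_fderiv_apply_eq_zero hg hc]
  simp

/-- A radial bump function: `1` on the closed unit disc, `0` for `‖z‖ ^ 2 ≥ 2`. -/
noncomputable def radialBump (z : ℂ) : ℂ := (Real.smoothTransition (2 - ‖z‖ ^ 2) : ℝ)

lemma contDiff_radialBump : ContDiff ℝ 1 radialBump := by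
  unfold radialBump
  exact Complex.ofRealCLM.contDiff.comp
    (Real.smoothTransition.contDiff.comp (contDiff_const.sub (contDiff_norm_sq ℝ)))

lemma hasCompactSupport_radialBump : HasCompactSupport radialBump := by
  refine HasCompactSupport.intro (isCompact_closedBall (0 : ℂ) 2) fun z hz => ?_
  have : 2 < ‖z‖ := by simpa using hz
  simp only [radialBump, Complex.ofReal_eq_zero]
  exact Real.smoothTransition.zero_of_nonpos (by nlinarith)

lemma radialBump_eventuallyEq_one : radialBump =ᶠ[𝓝 0] fun _ => 1 := by
  filter_upwards [Metric.ball_mem_nhds (0 : ℂ) one_pos] with z hz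
  have : ‖z‖ < 1 := by simpa using hz
  simp only [radialBump, Complex.ofReal_eq_one]
  exact Real.smoothTransition.one_of_one_le (by nlinarith [norm_nonneg z])

lemma dbar_radialBump (z : ℂ) :
    dbar radialBump z = z * ((-2 * deriv Real.smoothTransition (2 - ‖z‖ ^ 2) : ℝ) : ℂ) := by
  have h1 : HasFDerivAt (fun z : ℂ => 2 - ‖z‖ ^ 2) (-(2 • innerSL ℝ z)) z := by
    simpa using (hasStrictFDerivAt_norm_sq z).hasFDerivAt.const_sub 2
  have h2 : HasDerivAt Real.smoothTransition (deriv Real.smoothTransition (2 - ‖z‖ ^ 2))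
      (2 - ‖z‖ ^ 2) :=
    ((Real.smoothTransition.contDiff (n := 1)).differentiable one_ne_zero _).hasDerivAt
  have h3 := Complex.ofRealCLM.hasFDerivAt.comp z (h2.comp_hasFDerivAt z h1)
  change HasFDerivAt radialBump _ z at h3
  simp only [dbar, h3.fderiv]
  apply Complex.ext <;> simp [mul_assoc, mul_comm, mul_left_comm]

lemma dbar_radialBump_div (z : ℂ) : dbar radialBump z / z =
    ((-2 * deriv Real.smoothTransition (2 - ‖z‖ ^ 2) : ℝ) : ℂ) := by
  rcases eq_or_ne z 0 with rfl | hz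
  -- for `z = 0` the left side is the junk value `0`
  · have : (fun x : ℝ => Real.smoothTransition x) =ᶠ[𝓝 2] fun _ => 1 := by
      filter_upwards [lt_mem_nhds (show (1 : ℝ) < 2 by norm_num)] with x hx
      exact Real.smoothTransition.one_of_one_le hx.le
    have h : deriv Real.smoothTransition 2 = 0 := by
      have := this.deriv_eq
      simpa using this
    simp [h]
  · rw [dbar_radialBump, mul_div_cancel_left₀ _ hz]

lemma continuous_dbar_radialBump_div : Continuous fun z => dbar radialBump z / z := by
  simp only [dbar_radialBump_div]
  have := (Real.smoothTransition.contDiff (n := 1)).continuous_deriv le_rfl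
  fun_prop

lemma hasCompactSupport_dbar_radialBump_div :
    HasCompactSupport fun z => dbar radialBump z / z :=
  hasCompactSupport_radialBump.dbar.mono fun z hz => by
    simp only [Function.mem_support] at hz ⊢
    exact fun h => hz (by simp [h])

/-- The constant of the Cauchy–Pompeiu formula. Only that it is nonzero matters (its value
is `-2π`), and this holds because the integrand is real of constant sign. -/
lemma integral_dbar_radialBump_div_ne_zero : ∫ z, dbar radialBump z / z ≠ 0 := by
  set k : ℂ → ℝ := fun z => 2 * deriv Real.smoothTransition (2 - ‖z‖ ^ 2) with hk
  have hkd : ∀ z, dbar radialBump z / z = ((-k z : ℝ) : ℂ) := fun z => by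
    rw [dbar_radialBump_div, hk]; simp
  have hd := (Real.smoothTransition.contDiff (n := 1)).continuous_deriv le_rfl
  have hkc : Continuous k := by fun_prop
  have hks : HasCompactSupport k := by
    refine hasCompactSupport_dbar_radialBump_div.mono fun z hz => ?_
    simp only [Function.mem_support] at hz ⊢
    rw [hkd]
    simpa using hz
  have hk0 : 0 ≤ k := fun z => mul_nonneg two_pos.le (Real.smoothTransition.monotone.deriv_nonneg)
  have hne : k ≠ 0 := by
    intro h0
    have hz : ∀ x ∈ interior (Set.Icc (0 : ℝ) 1), deriv Real.smoothTransition x = 0 := by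
      intro x hx
      rw [interior_Icc] at hx
      have := congrFun h0 ((Real.sqrt (2 - x) : ℝ) : ℂ)
      simp only [hk, Complex.norm_real, Real.norm_eq_abs, sq_abs, Pi.zero_apply] at this
      rw [Real.sq_sqrt (by linarith [hx.2])] at this
      simpa using this
    have h01 := (antitoneOn_of_deriv_nonpos (convex_Icc (0 : ℝ) 1)
      (Real.smoothTransition.continuous).continuousOn
      ((Real.smoothTransition.contDiff (n := 1)).differentiable one_ne_zero).differentiableOn
      (fun x hx => (hz x hx).le)) (show (0 : ℝ) ∈ Set.Icc (0 : ℝ) 1 by simp)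
      (show (1 : ℝ) ∈ Set.Icc (0 : ℝ) 1 by simp) zero_le_one
    simp at h01
    linarith
  have hpos : 0 < ∫ z, k z :=
    hkc.integral_pos_of_hasCompactSupport_nonneg_nonzero hks hk0 (Function.ne_iff.1 hne).choose_spec
  simp only [hkd, integral_complex_ofReal, MeasureTheory.integral_neg]
  simpa using hpos.ne'

/-- A holomorphic function times a cutoff supported in its domain is globally `C¹`, with the
junk values of `f` outside its domain killed by the cutoff. -/
lemma contDiff_cutoff_mul {G : Set ℂ} (hG : IsOpen G) {f : ℂ → ℂ}
    (hf : DifferentiableOn ℂ f G) {φ : ℂ → ℂ} (hφ : ContDiff ℝ 1 φ) (hφG : tsupport φ ⊆ G) :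
    ContDiff ℝ 1 fun z => φ z * f z := by
  rw [contDiff_iff_contDiffAt]
  intro z
  by_cases hz : z ∈ tsupport φ
  · have h1 : ContDiffAt ℂ 1 f z :=
      (hf.analyticAt (hG.mem_nhds (hφG hz))).contDiffAt
    exact hφ.contDiffAt.mul (h1.restrict_scalars ℝ)
  · have h0 : (fun z => φ z * f z) =ᶠ[𝓝 z] fun _ => 0 := by
      filter_upwards [notMem_tsupport_iff_eventuallyEq.1 hz] with x hx
      simp [hx]
    exact contDiffAt_const.congr_of_eventuallyEq h0

lemma dbar_cutoff_mul {G : Set ℂ} (hG : IsOpen G) {f : ℂ → ℂ}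
    (hf : DifferentiableOn ℂ f G) {φ : ℂ → ℂ} (hφ : ContDiff ℝ 1 φ) (hφG : tsupport φ ⊆ G)
    (z : ℂ) : dbar (fun z => φ z * f z) z = dbar φ z * f z := by
  by_cases hz : z ∈ tsupport φ
  · have h1 : DifferentiableAt ℂ f z := hf.differentiableAt (hG.mem_nhds (hφG hz))
    rw [dbar_mul (hφ.differentiable one_ne_zero z) (h1.restrictScalars ℝ), h1.dbar_eq_zero]
    ring
  · have h0 : (fun z => φ z * f z) =ᶠ[𝓝 z] fun _ => 0 := by
      filter_upwards [notMem_tsupport_iff_eventuallyEq.1 hz] with x hx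
      simp [hx]
    rw [h0.dbar_eq, dbar_const, dbar_eq_zero_of_notMem_tsupport hz, zero_mul]

/-- If `u : ℂ → E` is continuous on `G` away from the set where the cutoff `φ` is locally `1`,
then `dbar φ • u` is continuous. -/
lemma continuous_dbar_smul {E : Type*} [NormedAddCommGroup E] [NormedSpace ℂ E] {φ : ℂ → ℂ}
    (hφ : ContDiff ℝ 1 φ) {u : ℂ → E}
    (hu : ∀ z ∈ tsupport φ, ¬ φ =ᶠ[𝓝 z] (fun _ => 1) → ContinuousAt u z) :
    Continuous fun z => dbar φ z • u z := by
  rw [continuous_iff_continuousAt]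
  intro z
  have key : ∀ c : ℂ, φ =ᶠ[𝓝 z] (fun _ => c) → ContinuousAt (fun z => dbar φ z • u z) z := by
    intro c hc
    have h0 : (fun z => dbar φ z • u z) =ᶠ[𝓝 z] fun _ => 0 := by
      filter_upwards [hc.eventuallyEq_nhds] with x hx
      rw [hx.dbar_eq, dbar_const, zero_smul]
    exact continuousAt_const.congr h0.symm
  by_cases hz : z ∈ tsupport φ
  · by_cases h1 : φ =ᶠ[𝓝 z] fun _ => 1
    · exact key 1 h1
    · exact hφ.continuous_dbar.continuousAt.smul (hu z hz h1)
  · exact key 0 (notMem_tsupport_iff_eventuallyEq.1 hz)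

lemma HasCompactSupport.dbar_smul {E : Type*} [NormedAddCommGroup E] [NormedSpace ℂ E]
    {φ : ℂ → ℂ} (hφ : HasCompactSupport φ) (u : ℂ → E) :
    HasCompactSupport fun z => _root_.dbar φ z • u z :=
  HasCompactSupport.intro hφ fun z hz => by
    rw [dbar_eq_zero_of_notMem_tsupport hz, zero_smul]

/-- **Cauchy–Pompeiu formula** for a holomorphic function times a cutoff. It is obtained by
integrating `∂/∂z̄` of the compactly supported `C¹` function
`(φ z * f z - radialBump (z - z₀) * f z₀) / (z - z₀)`, which avoids any contour. -/
lemma integral_dbar_cutoff_mul {G : Set ℂ} (hG : IsOpen G) {f : ℂ → ℂ}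
    (hf : DifferentiableOn ℂ f G) {φ : ℂ → ℂ} (hφ : ContDiff ℝ 1 φ)
    (hφc : HasCompactSupport φ) (hφG : tsupport φ ⊆ G) {z₀ : ℂ}
    (h1 : φ =ᶠ[𝓝 z₀] fun _ => 1) :
    ∫ z, dbar φ z * f z * (z - z₀)⁻¹ = f z₀ * ∫ z, dbar radialBump z / z := by
  have hz₀ : z₀ ∈ G := hφG (subset_tsupport _ (by simp [h1.eq_of_nhds]))
  set B : ℂ → ℂ := fun z => radialBump (z - z₀) with hB
  have hBc : ContDiff ℝ 1 B := contDiff_radialBump.comp (contDiff_id.sub contDiff_const)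
  have hB1 : B =ᶠ[𝓝 z₀] fun _ => 1 := by
    have : Tendsto (fun z => z - z₀) (𝓝 z₀) (𝓝 0) := by
      have : Continuous fun z => z - z₀ := by fun_prop
      simpa using this.tendsto z₀
    exact this.eventually radialBump_eventuallyEq_one
  have hBs : HasCompactSupport B := by
    simpa [hB, sub_eq_add_neg, Function.comp_def] using
      hasCompactSupport_radialBump.comp_homeomorph (Homeomorph.addRight (-z₀))
  set F : ℂ → ℂ := fun z => φ z * f z - B z * f z₀ with hF
  have hφf := contDiff_cutoff_mul hG hf hφ hφG
  have hFc : ContDiff ℝ 1 F := hφf.sub (hBc.mul contDiff_const)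
  have hFs : HasCompactSupport F := (hφc.mul_right).sub hBs.mul_right
  have hF1 : F =ᶠ[𝓝 z₀] fun z => f z - f z₀ := by
    filter_upwards [h1, hB1] with z hz hz'
    simp [hF, hz, hz']
  set q : ℂ → ℂ := fun z => F z * (z - z₀)⁻¹ with hq
  -- `q` has the junk value `0` at `z₀`, where `d` has the right one
  set d : ℂ → ℂ := Function.update q z₀ (deriv f z₀) with hd
  have hdq : ∀ z ≠ z₀, d =ᶠ[𝓝 z] q := fun z hz => by
    filter_upwards [isOpen_ne.mem_nhds hz] with x hx
    simp only [hd, Function.update_of_ne hx]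
  have hinv : ∀ z ≠ z₀, DifferentiableAt ℂ (fun x => (x - z₀)⁻¹) z := fun z hz =>
    (differentiableAt_id.sub_const z₀).inv (sub_ne_zero.2 hz)
  have hd0 : d =ᶠ[𝓝 z₀] dslope f z₀ := by
    filter_upwards [hF1] with x hx
    rcases eq_or_ne x z₀ with rfl | hne
    · simp [hd]
    · simp only [hd, Function.update_of_ne hne, hq, hx, dslope_of_ne _ hne, slope_def_field]
      rw [div_eq_mul_inv]
  have hdc : ContDiff ℝ 1 d := by
    rw [contDiff_iff_contDiffAt]
    intro z
    rcases eq_or_ne z z₀ with rfl | hz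
    · have h2 : DifferentiableOn ℂ (dslope f z) G :=
        (Complex.differentiableOn_dslope (hG.mem_nhds hz₀)).2 hf
      have h3 : ContDiffAt ℂ 1 (dslope f z) z := (h2.analyticAt (hG.mem_nhds hz₀)).contDiffAt
      exact (h3.restrict_scalars ℝ).congr_of_eventuallyEq hd0
    · refine ContDiffAt.congr_of_eventuallyEq ?_ (hdq z hz)
      have : ContDiffAt ℂ 1 (fun x => (x - z₀)⁻¹) z :=
        (contDiffAt_id.sub contDiffAt_const).inv (sub_ne_zero.2 hz)
      exact hFc.contDiffAt.mul (this.restrict_scalars ℝ)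
  have hds : HasCompactSupport d := by
    refine HasCompactSupport.intro (hFs.isCompact.union (isCompact_singleton (x := z₀)))
      fun z hz => ?_
    simp only [Set.mem_union, Set.mem_singleton_iff, not_or] at hz
    simp only [hd, Function.update_of_ne hz.2, hq, image_eq_zero_of_notMem_tsupport hz.1, zero_mul]
  have hdbar : ∀ z ≠ z₀, dbar d z =
      dbar φ z * f z * (z - z₀)⁻¹ - f z₀ * (dbar radialBump (z - z₀) / (z - z₀)) := by
    intro z hz
    have hc : DifferentiableAt ℝ (fun z => B z * f z₀) z :=
      (hBc.mul contDiff_const).differentiable one_ne_zero z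
    rw [(hdq z hz).dbar_eq, dbar_mul (hFc.differentiable one_ne_zero z)
      ((hinv z hz).restrictScalars ℝ), (hinv z hz).dbar_eq_zero,
      dbar_sub (hφf.differentiable one_ne_zero z) hc,
      dbar_cutoff_mul hG hf hφ hφG,
      dbar_mul (hBc.differentiable one_ne_zero z) (differentiableAt_const _), dbar_const,
      hB, dbar_comp_sub]
    ring
  have hi1 : MeasureTheory.Integrable fun z => dbar φ z * f z * (z - z₀)⁻¹ := by
    have hc := continuous_dbar_smul hφ (u := fun z => f z * (z - z₀)⁻¹) fun z hz hz1 => by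
      have hne : z ≠ z₀ := by rintro rfl; exact hz1 h1
      exact (hf.differentiableAt (hG.mem_nhds (hφG hz))).continuousAt.mul
        (hinv z hne).continuousAt
    simpa [mul_assoc] using hc.integrable_of_hasCompactSupport (hφc.dbar_smul _)
  have hi2 : MeasureTheory.Integrable fun z => f z₀ * (dbar radialBump (z - z₀) / (z - z₀)) :=
    ((continuous_dbar_radialBump_div.integrable_of_hasCompactSupport
      hasCompactSupport_dbar_radialBump_div).comp_sub_right z₀).const_mul _
  have hae : dbar d =ᵐ[MeasureTheory.volume] fun z =>
      dbar φ z * f z * (z - z₀)⁻¹ - f z₀ * (dbar radialBump (z - z₀) / (z - z₀)) := by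
    have : ({z₀}ᶜ : Set ℂ) ∈ MeasureTheory.ae MeasureTheory.volume :=
      MeasureTheory.compl_mem_ae_iff.2 (MeasureTheory.measure_singleton z₀)
    filter_upwards [this] with z hz using hdbar z hz
  have h0 := integral_dbar_eq_zero hdc hds
  rw [MeasureTheory.integral_congr_ae hae, MeasureTheory.integral_sub hi1 hi2,
    MeasureTheory.integral_const_mul,
    MeasureTheory.integral_sub_right_eq_self (fun z => dbar radialBump z / z) z₀] at h0
  exact sub_eq_zero.1 h0

open scoped Manifold ContDiff in
lemma exists_complex_cutoff {K G : Set ℂ} (hK : IsCompact K) (hG : IsOpen G) (hKG : K ⊆ G) :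
    ∃ φ : ℂ → ℂ, ContDiff ℝ 1 φ ∧ HasCompactSupport φ ∧ tsupport φ ⊆ G ∧
      ∀ z ∈ K, φ =ᶠ[𝓝 z] fun _ => 1 := by
  obtain ⟨t, htc, hKt, htG⟩ := exists_compact_between hK hG hKG
  obtain ⟨g, hg1, hg0, -⟩ := exists_contMDiffMap_one_nhds_of_subset_interior 𝓘(ℝ, ℂ) (n := 1)
    hK.isClosed hKt
  have hsupp : tsupport (fun z => ((g z : ℝ) : ℂ)) ⊆ t := by
    refine closure_minimal (fun z hz => ?_) htc.isClosed
    by_contra hzt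
    exact hz (by simp [hg0 z hzt])
  refine ⟨fun z => ((g z : ℝ) : ℂ), ?_, htc.of_isClosed_subset (isClosed_tsupport _) hsupp,
    hsupp.trans htG, fun z hz => ?_⟩
  · exact Complex.ofRealCLM.contDiff.comp g.contMDiff.contDiff
  · filter_upwards [eventually_nhdsSet_iff_forall.1 hg1 z hz] with x hx
    simp [hx]

/-- **Holomorphic functional calculus**: in a commutative complex Banach algebra, a function
holomorphic near the spectrum of `x` can be applied to the Gelfand transform of `x`. The
element is `∫ ∂φ/∂z̄ (z) f(z) (z - x)⁻¹`, suitably normalised, for a cutoff `φ` equal to `1`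
near the spectrum. -/
theorem exists_forall_character_eq_comp {A : Type*} [NormedCommRing A] [NormedAlgebra ℂ A]
    [CompleteSpace A] (x : A) {G : Set ℂ} (hG : IsOpen G) {f : ℂ → ℂ}
    (hf : DifferentiableOn ℂ f G) (hx : spectrum ℂ x ⊆ G) :
    ∃ y : A, ∀ χ : WeakDual.characterSpace ℂ A, χ y = f (χ x) := by
  obtain ⟨φ, hφ, hφc, hφG, hφ1⟩ := exists_complex_cutoff (spectrum.isCompact x) hG hx
  set C := ∫ z, dbar radialBump z / z with hC
  set u : ℂ → A := fun z => f z • resolvent x z with hu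
  have hcont : Continuous fun z => dbar φ z • u z := by
    refine continuous_dbar_smul hφ fun z hz hz1 => ?_
    have hzr : z ∈ resolventSet ℂ x := by
      by_contra h
      exact hz1 (hφ1 z h)
    exact (hf.differentiableAt (hG.mem_nhds (hφG hz))).continuousAt.smul
      (spectrum.hasDerivAt_resolvent_const_left hzr).continuousAt
  have hint := hcont.integrable_of_hasCompactSupport (μ := MeasureTheory.volume)
    (hφc.dbar_smul u)
  refine ⟨C⁻¹ • ∫ z, dbar φ z • u z, fun χ => ?_⟩
  have hχ : χ x ∈ spectrum ℂ x := WeakDual.CharacterSpace.mem_spectrum_iff_exists.2 ⟨χ, rfl⟩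
  have h1 : χ (∫ z, dbar φ z • u z) = ∫ z, dbar φ z * f z * (z - χ x)⁻¹ := by
    have h2 := (WeakDual.CharacterSpace.toCLM χ).integral_comp_comm hint
    refine h2.symm.trans (MeasureTheory.integral_congr_ae (Eventually.of_forall fun z => ?_))
    change χ (dbar φ z • u z) = dbar φ z * f z * (z - χ x)⁻¹
    rw [map_smul, hu, map_smul, smul_eq_mul, smul_eq_mul, ← mul_assoc]
    by_cases hz : z ∈ spectrum ℂ x
    · rw [(hφ1 z hz).dbar_eq, dbar_const, zero_mul, zero_mul, zero_mul]
    · have hmul : (algebraMap ℂ A z - x) * resolvent x z = 1 :=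
        Ring.mul_inverse_cancel _ (spectrum.notMem_iff.1 hz)
      have := congrArg χ hmul
      rw [map_mul, map_sub, map_one, AlgHomClass.commutes, Algebra.algebraMap_self,
        RingHom.id_apply] at this
      rw [← eq_inv_of_mul_eq_one_right this]
  rw [map_smul, h1, integral_dbar_cutoff_mul hG hf hφ hφc hφG (hφ1 _ hχ), smul_eq_mul, ← hC,
    mul_comm (f _), inv_mul_cancel_left₀ integral_dbar_radialBump_div_ne_zero]

/-! ### Finite trigonometric sums -/

open Complex in
/-- The character `t ↦ exp (-i ⟨x, t⟩)` of `ℝ^r` with frequency `x`, in the sign convention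
of Dirichlet series on the boundary `s = i t`. -/
noncomputable def expChar {r : ℕ} (x t : Fin r → ℝ) : ℂ :=
  exp (-∑ i, (x i : ℂ) * (I * t i))

lemma expChar_eq {r : ℕ} (x t : Fin r → ℝ) :
    expChar x t = Complex.exp ((-(x ⬝ᵥ t) : ℝ) * Complex.I) := by
  simp only [expChar, dotProduct, Complex.ofReal_neg, Complex.ofReal_sum, Complex.ofReal_mul,
    neg_mul, Finset.sum_mul]
  congr 2
  exact Finset.sum_congr rfl fun i _ => by ring

lemma norm_expChar {r : ℕ} (x t : Fin r → ℝ) : ‖expChar x t‖ = 1 := by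
  rw [expChar_eq, Complex.norm_exp_ofReal_mul_I]

lemma expChar_add_right {r : ℕ} (x t h : Fin r → ℝ) :
    expChar x (t + h) = expChar x t * expChar x h := by
  simp only [expChar_eq, ← Complex.exp_add, dotProduct_add]
  congr 1; push_cast; ring

lemma expChar_sub_left {r : ℕ} (x y t : Fin r → ℝ) :
    expChar (x - y) t = expChar x t * (starRingEnd ℂ) (expChar y t) := by
  simp only [expChar_eq, ← Complex.exp_conj, ← Complex.exp_add, sub_dotProduct, map_mul,
    Complex.conj_ofReal, Complex.conj_I]
  congr 1; push_cast; ring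

lemma exists_expChar_eq_neg_one {r : ℕ} {x : Fin r → ℝ} (hx : x ≠ 0) :
    ∃ h : Fin r → ℝ, expChar x h = -1 := by
  refine ⟨(-(Real.pi / (x ⬝ᵥ x))) • x, ?_⟩
  have : x ⬝ᵥ x ≠ 0 := fun h => hx (dotProduct_self_eq_zero.1 h)
  rw [expChar_eq, dotProduct_smul, smul_eq_mul, neg_mul, neg_neg, div_mul_cancel₀ _ this,
    Complex.exp_pi_mul_I]

/-- The constant term of a bounded trigonometric sum is bounded by the same constant: averaging
over translates by `0` and `h` with `expChar x h = -1` removes the frequency `x ≠ 0` and keeps the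
constant term. -/
lemma norm_constant_le_of_norm_trigSum_le {r : ℕ} {ι : Type*} (J : Finset ι)
    (x : ι → Fin r → ℝ) (hx : ∀ i ∈ J, x i ≠ 0) (c₀ : ℂ) (c : ι → ℂ) {C : ℝ}
    (hC : ∀ t, ‖c₀ + ∑ i ∈ J, c i * expChar (x i) t‖ ≤ C) : ‖c₀‖ ≤ C := by
  classical
  induction J using Finset.induction_on generalizing c with
  | empty => simpa using hC 0
  | insert j J hj ih =>
    obtain ⟨h, hh⟩ := exists_expChar_eq_neg_one (hx j (Finset.mem_insert_self j J))
    refine ih (fun i hi => hx i (Finset.mem_insert_of_mem hi))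
      (fun i => c i * ((1 + expChar (x i) h) / 2)) fun t => ?_
    have h1 := hC t
    have h2 := hC (t + h)
    rw [Finset.sum_insert hj] at h1 h2
    have key : c₀ + ∑ i ∈ J, c i * ((1 + expChar (x i) h) / 2) * expChar (x i) t =
        ((c₀ + (c j * expChar (x j) t + ∑ i ∈ J, c i * expChar (x i) t)) +
        (c₀ + (c j * expChar (x j) (t + h) + ∑ i ∈ J, c i * expChar (x i) (t + h)))) / 2 := by
      have : ∑ i ∈ J, c i * ((1 + expChar (x i) h) / 2) * expChar (x i) t =
          (∑ i ∈ J, c i * expChar (x i) t + ∑ i ∈ J, c i * expChar (x i) (t + h)) / 2 := by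
        rw [← Finset.sum_add_distrib, Finset.sum_div]
        refine Finset.sum_congr rfl fun i _ => ?_
        rw [expChar_add_right]
        ring
      rw [this, expChar_add_right (x j), hh]
      ring
    rw [key, norm_div, Complex.norm_ofNat]
    have := norm_add_le (c₀ + (c j * expChar (x j) t + ∑ i ∈ J, c i * expChar (x i) t))
      (c₀ + (c j * expChar (x j) (t + h) + ∑ i ∈ J, c i * expChar (x i) (t + h)))
    linarith

/-- Bessel's inequality for finite trigonometric sums with arbitrary real frequencies. -/
lemma sum_norm_sq_le_of_norm_trigSum_le {r : ℕ} {ι : Type*} (S : Finset ι)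
    {x : ι → Fin r → ℝ} (hx : Function.Injective x) (c : ι → ℂ) {C : ℝ}
    (hC : ∀ t, ‖∑ i ∈ S, c i * expChar (x i) t‖ ≤ C) :
    ∑ i ∈ S, ‖c i‖ ^ 2 ≤ C ^ 2 := by
  classical
  have h := norm_constant_le_of_norm_trigSum_le S.offDiag (fun p => x p.1 - x p.2)
    (fun p hp => sub_ne_zero.2 (hx.ne (Finset.mem_offDiag.1 hp).2.2))
    (((∑ i ∈ S, ‖c i‖ ^ 2 : ℝ)) : ℂ) (fun p => c p.1 * (starRingEnd ℂ) (c p.2))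
    (C := C ^ 2) fun t => by
      have key : ((∑ i ∈ S, ‖c i‖ ^ 2 : ℝ) : ℂ) + ∑ p ∈ S.offDiag,
          c p.1 * (starRingEnd ℂ) (c p.2) * expChar (x p.1 - x p.2) t =
          (∑ i ∈ S, c i * expChar (x i) t) * (starRingEnd ℂ) (∑ i ∈ S, c i * expChar (x i) t) := by
        rw [map_sum, Finset.sum_mul_sum, ← Finset.sum_product', ← Finset.diag_union_offDiag,
          Finset.sum_union (Finset.disjoint_diag_offDiag S), Finset.sum_diag]
        congr 1
        · push_cast
          refine Finset.sum_congr rfl fun i _ => ?_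
          rw [Complex.mul_conj', norm_mul, norm_expChar, mul_one]
        · refine Finset.sum_congr rfl fun p _ => ?_
          rw [expChar_sub_left, map_mul]
          ring
      rw [key, norm_mul, RCLike.norm_conj, ← sq]
      exact pow_le_pow_left₀ (norm_nonneg _) (hC t) 2
  rw [Complex.norm_real] at h
  exact (le_abs_self _).trans h

open scoped Pointwise in
/-- The support of the `k`-th power of an element of a monoid algebra grows only polynomially
in `k`. -/
lemma card_support_pow_le {M : Type*} [AddCommMonoid M] (p : AddMonoidAlgebra ℂ M) (k : ℕ) :
    (p ^ k).coeff.support.card ≤ (k + 1) ^ p.coeff.support.card := by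
  classical
  set S := p.coeff.support with hS
  set T : ℕ → Finset M := fun k =>
    (Fintype.piFinset fun _ : S => Finset.range (k + 1)).image fun m => ∑ x : S, m x • (x : M) with hT
  have hsub : ∀ k, (p ^ k).coeff.support ⊆ T k := by
    intro k
    induction k with
    | zero =>
      intro y hy
      have : y = 0 := by
        rw [pow_zero, AddMonoidAlgebra.one_def, AddMonoidAlgebra.coeff_single] at hy
        simpa using hy
      simp only [hT, Finset.mem_image, Fintype.mem_piFinset]
      exact ⟨0, by simp, by simp [this]⟩
    | succ k ih =>
      intro y hy
      rw [pow_succ] at hy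
      have hy' := AddMonoidAlgebra.support_coeff_mul_subset _ _ hy
      obtain ⟨a, ha, b, hb, rfl⟩ := Finset.mem_add.1 hy'
      obtain ⟨m, hm, rfl⟩ := Finset.mem_image.1 (ih ha)
      rw [Fintype.mem_piFinset] at hm
      refine Finset.mem_image.2 ⟨m + Pi.single ⟨b, hb⟩ 1, ?_, ?_⟩
      · rw [Fintype.mem_piFinset]
        intro x
        have h1 := Finset.mem_range.1 (hm x)
        have h2 : (Pi.single (⟨b, hb⟩ : S) 1 : S → ℕ) x ≤ 1 := by
          rw [Pi.single_apply]; split_ifs <;> simp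
        rw [Finset.mem_range, Pi.add_apply]
        omega
      · simp [add_smul, Finset.sum_add_distrib, Pi.single_apply, ite_smul]
  calc _ ≤ (T k).card := Finset.card_le_card (hsub k)
    _ ≤ _ := Finset.card_image_le
    _ = _ := by simp

lemma le_of_forall_pow_le_polynomial_mul {a C : ℝ} (hC : 0 ≤ C) (n : ℕ)
    (h : ∀ k : ℕ, a ^ k ≤ ((k : ℝ) + 1) ^ n * C ^ k) : a ≤ C := by
  by_contra! hlt
  rcases hC.eq_or_lt with rfl | hC
  · have := h 1
    simp at this
    linarith
  · set q := C / a with hq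
    have ha' : 0 < a := hC.trans hlt
    have hq1 : |q| < 1 := by
      rw [abs_of_pos (by positivity)]
      exact (div_lt_one ha').2 hlt
    have h1 := (tendsto_pow_const_mul_const_pow_of_abs_lt_one n hq1).comp (tendsto_add_atTop_nat 1)
    have h2 : ∀ k : ℕ, q ≤ (((k + 1 : ℕ) : ℝ)) ^ n * q ^ (k + 1) := by
      intro k
      have := h k
      rw [hq, div_pow, ← mul_div_assoc, le_div_iff₀ (by positivity), pow_succ a,
        div_mul_eq_mul_div, div_le_iff₀ ha']
      push_cast
      calc C * (a ^ k * a) = C * a * a ^ k := by ring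
        _ ≤ C * a * (((k : ℝ) + 1) ^ n * C ^ k) := by gcongr
        _ = _ := by ring
    have := ge_of_tendsto' h1 h2
    have : 0 < q := by positivity
    linarith

/-- The character `x ↦ exp (-⟨x, s⟩)` of a submonoid of `ℝ^r`. -/
noncomputable def dirichletChar {r : ℕ} (L : AddSubmonoid (Fin r → ℝ)) (s : Fin r → ℂ) :
    Multiplicative L →* ℂ where
  toFun x := Complex.exp (-∑ i, ((x.toAdd : Fin r → ℝ) i : ℂ) * s i)
  map_one' := by simp
  map_mul' x y := by
    rw [← Complex.exp_add]
    congr 1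
    simp [add_mul, Finset.sum_add_distrib, add_comm]

/-- The boundary point `i t` of the right half space. -/
noncomputable def boundaryPoint {r : ℕ} (t : Fin r → ℝ) : Fin r → ℂ := fun i => Complex.I * t i

/-- **Boundary maximum principle.** A bound for a Dirichlet polynomial on the imaginary boundary
`i ℝ^r` bounds its value at *every* homomorphism from the frequency monoid to the closed unit
disc, including those with zeros. By Bessel's inequality the `ℓ²` norm of the coefficients of
the `k`-th power is at most `C ^ k`, and their `ℓ¹` norm exceeds this only by a factor
polynomial in `k`. -/
lemma norm_lift_le_of_norm_boundary_le {r : ℕ} {L : AddSubmonoid (Fin r → ℝ)}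
    (p : AddMonoidAlgebra ℂ L) {C : ℝ}
    (hC : ∀ t, ‖AddMonoidAlgebra.lift ℂ ℂ L (dirichletChar L (boundaryPoint t)) p‖ ≤ C)
    (χ : Multiplicative L →* ℂ) (hχ : ∀ x, ‖χ x‖ ≤ 1) :
    ‖AddMonoidAlgebra.lift ℂ ℂ L χ p‖ ≤ C := by
  have hC0 : 0 ≤ C := (norm_nonneg _).trans (hC 0)
  refine (abs_le_of_sq_le_sq' ?_ hC0).2
  refine le_of_forall_pow_le_polynomial_mul (sq_nonneg C) p.coeff.support.card fun k => ?_
  set q := p ^ k with hq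
  have h2 : ∑ x ∈ q.coeff.support, ‖q.coeff x‖ ^ 2 ≤ (C ^ k) ^ 2 := by
    refine sum_norm_sq_le_of_norm_trigSum_le q.coeff.support Subtype.val_injective q.coeff
      fun t => ?_
    have h3 : ‖AddMonoidAlgebra.lift ℂ ℂ L (dirichletChar L (boundaryPoint t)) q‖ ≤ C ^ k := by
      rw [hq, map_pow, norm_pow]
      exact pow_le_pow_left₀ (norm_nonneg _) (hC t) k
    rwa [AddMonoidAlgebra.lift_apply] at h3
  have h1 : ‖AddMonoidAlgebra.lift ℂ ℂ L χ q‖ ≤ ∑ x ∈ q.coeff.support, ‖q.coeff x‖ := by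
    rw [AddMonoidAlgebra.lift_apply]
    refine norm_sum_le_of_le _ fun x _ => ?_
    rw [norm_smul]
    exact mul_le_of_le_one_right (norm_nonneg _) (hχ _)
  calc (‖AddMonoidAlgebra.lift ℂ ℂ L χ p‖ ^ 2) ^ k = ‖AddMonoidAlgebra.lift ℂ ℂ L χ q‖ ^ 2 := by
        rw [hq, map_pow, norm_pow]; ring
    _ ≤ (∑ x ∈ q.coeff.support, ‖q.coeff x‖) ^ 2 := by gcongr
    _ ≤ q.coeff.support.card * ∑ x ∈ q.coeff.support, ‖q.coeff x‖ ^ 2 :=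
        sq_sum_le_card_mul_sum_sq
    _ ≤ ((k : ℝ) + 1) ^ p.coeff.support.card * (C ^ k) ^ 2 := by
        gcongr
        exact_mod_cast card_support_pow_le p k
    _ = _ := by ring

/-! ### The weighted convolution algebra as a Banach algebra -/

section WeightedNorm

variable {M : Type*} {w : M → ℝ}

/-- The norm `∑ x, ‖p x‖ * w x` on finitely supported functions. -/
noncomputable def weightedNorm (w : M → ℝ) (p : AddMonoidAlgebra ℂ M) : ℝ :=
  p.coeff.sum fun x c => ‖c‖ * w x

lemma weightedNorm_eq_sum {p : AddMonoidAlgebra ℂ M} {S : Finset M} (hS : p.coeff.support ⊆ S) :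
    weightedNorm w p = ∑ x ∈ S, ‖p.coeff x‖ * w x :=
  Finsupp.sum_of_support_subset _ hS _ (by simp)

lemma weightedNorm_zero : weightedNorm w 0 = 0 := by simp [weightedNorm]

lemma weightedNorm_single (x : M) (c : ℂ) :
    weightedNorm w (AddMonoidAlgebra.single x c) = ‖c‖ * w x := by
  simp [weightedNorm, AddMonoidAlgebra.coeff_single, Finsupp.sum_single_index]

lemma weightedNorm_add_le (hw : ∀ x, 0 ≤ w x) (p q : AddMonoidAlgebra ℂ M) :
    weightedNorm w (p + q) ≤ weightedNorm w p + weightedNorm w q := by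
  classical
  rw [weightedNorm_eq_sum (p := p) (Finset.subset_union_left (s₂ := q.coeff.support)),
    weightedNorm_eq_sum (p := q) (Finset.subset_union_right (s₁ := p.coeff.support)),
    weightedNorm_eq_sum (p := p + q) Finsupp.support_add, ← Finset.sum_add_distrib]
  refine Finset.sum_le_sum fun x _ => ?_
  rw [← add_mul]
  exact mul_le_mul_of_nonneg_right (norm_add_le _ _) (hw x)

lemma weightedNorm_sum_le (hw : ∀ x, 0 ≤ w x) {ι : Type*} (S : Finset ι)
    (p : ι → AddMonoidAlgebra ℂ M) :
    weightedNorm w (∑ i ∈ S, p i) ≤ ∑ i ∈ S, weightedNorm w (p i) :=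
  Finset.le_sum_of_subadditive _ weightedNorm_zero.le (weightedNorm_add_le hw) S p

lemma weightedNorm_smul (c : ℂ) (p : AddMonoidAlgebra ℂ M) :
    weightedNorm w (c • p) = ‖c‖ * weightedNorm w p := by
  rw [weightedNorm_eq_sum (p := c • p) Finsupp.support_smul, weightedNorm, Finsupp.sum,
    Finset.mul_sum]
  refine Finset.sum_congr rfl fun x _ => ?_
  rw [AddMonoidAlgebra.coeff_smul_apply, norm_smul, mul_assoc]

lemma weightedNorm_mul_le [AddCommMonoid M] (hw : IsWeight w) (p q : AddMonoidAlgebra ℂ M) :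
    weightedNorm w (p * q) ≤ weightedNorm w p * weightedNorm w q := by
  have h0 : ∀ x, 0 ≤ w x := fun x => (hw.pos x).le
  rw [AddMonoidAlgebra.mul_def]
  refine (weightedNorm_sum_le h0 _ _).trans ?_
  rw [weightedNorm, weightedNorm, Finsupp.sum, Finsupp.sum, Finset.sum_mul_sum]
  refine Finset.sum_le_sum fun x _ => (weightedNorm_sum_le h0 _ _).trans ?_
  refine Finset.sum_le_sum fun y _ => ?_
  rw [weightedNorm_single, norm_mul]
  calc ‖p.coeff x‖ * ‖q.coeff y‖ * w (x + y) ≤ ‖p.coeff x‖ * ‖q.coeff y‖ * (w x * w y) := by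
        gcongr; exact hw.map_add_le x y
    _ = _ := by ring

lemma eq_zero_of_weightedNorm_eq_zero (hw : ∀ x, 0 < w x) {p : AddMonoidAlgebra ℂ M}
    (hp : weightedNorm w p = 0) : p = 0 := by
  rw [weightedNorm, Finsupp.sum,
    Finset.sum_eq_zero_iff_of_nonneg fun x _ => mul_nonneg (norm_nonneg _) (hw x).le] at hp
  ext x
  by_contra hx
  have := hp x (Finsupp.mem_support_iff.2 hx)
  exact (mul_ne_zero (norm_ne_zero_iff.2 hx) (hw x).ne') this

end WeightedNorm

section BanachAlgebra

variable {M : Type*} [AddCommMonoid M] {w : M → ℝ}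

/-- The finitely supported elements of the weighted convolution algebra: the monoid algebra
of `M`, normed by `weightedNorm w`. -/
def WeightedMonoidAlgebra (_hw : IsWeight w) : Type _ := AddMonoidAlgebra ℂ M

namespace WeightedMonoidAlgebra

variable (hw : IsWeight w)

noncomputable instance : CommRing (WeightedMonoidAlgebra hw) :=
  inferInstanceAs (CommRing (AddMonoidAlgebra ℂ M))

noncomputable instance : Algebra ℂ (WeightedMonoidAlgebra hw) :=
  inferInstanceAs (Algebra ℂ (AddMonoidAlgebra ℂ M))

/-- `weightedNorm w` as a ring norm. -/
noncomputable def ringNorm : RingNorm (WeightedMonoidAlgebra hw) where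
  toFun := weightedNorm w
  map_zero' := weightedNorm_zero
  add_le' := weightedNorm_add_le fun x => (hw.pos x).le
  neg' p := by
    have := weightedNorm_smul (w := w) (-1) (show AddMonoidAlgebra ℂ M from p)
    rwa [neg_one_smul, norm_neg, norm_one, one_mul] at this
  mul_le' := weightedNorm_mul_le hw
  eq_zero_of_map_eq_zero' _ := eq_zero_of_weightedNorm_eq_zero hw.pos

noncomputable instance : NormedCommRing (WeightedMonoidAlgebra hw) where
  __ := (ringNorm hw).toNormedRing
  mul_comm := mul_comm

noncomputable instance : NormedAlgebra ℂ (WeightedMonoidAlgebra hw) where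
  norm_smul_le c p := (weightedNorm_smul c p).le

lemma norm_def (p : WeightedMonoidAlgebra hw) : ‖p‖ = weightedNorm w p := rfl

end WeightedMonoidAlgebra

/-- The Banach algebra `𝒜_w(M)`, realised as the completion of its finitely supported elements.
`exists_eq_ofCoeffs` identifies its elements with the weighted summable functions. -/
abbrev WeightedCompletion (hw : IsWeight w) : Type _ :=
  UniformSpace.Completion (WeightedMonoidAlgebra hw)

namespace WeightedCompletion

/-- The inclusion of the finitely supported functions. -/
noncomputable def ofFinite (hw : IsWeight w) :
    AddMonoidAlgebra ℂ M →ₐ[ℂ] WeightedCompletion hw where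
  __ := (UniformSpace.Completion.coeRingHom : WeightedMonoidAlgebra hw →+* _)
  commutes' _ := rfl

lemma norm_ofFinite (hw : IsWeight w) (p : AddMonoidAlgebra ℂ M) :
    ‖ofFinite hw p‖ = weightedNorm w p :=
  UniformSpace.Completion.norm_coe (E := WeightedMonoidAlgebra hw) p

lemma denseRange_ofFinite (hw : IsWeight w) : DenseRange (ofFinite hw) :=
  UniformSpace.Completion.denseRange_coe (α := WeightedMonoidAlgebra hw)

/-- The unit mass at `x`. -/
noncomputable def delta (hw : IsWeight w) (x : M) : WeightedCompletion hw :=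
  ofFinite hw (AddMonoidAlgebra.single x 1)

lemma norm_delta (hw : IsWeight w) (x : M) : ‖delta hw x‖ = w x := by
  rw [delta, norm_ofFinite, weightedNorm_single, norm_one, one_mul]

lemma delta_zero (hw : IsWeight w) : delta hw 0 = 1 := by
  rw [delta, ← AddMonoidAlgebra.one_def, map_one]

lemma delta_add (hw : IsWeight w) (x y : M) : delta hw (x + y) = delta hw x * delta hw y := by
  simp [delta, ← map_mul]

lemma ofFinite_eq_sum (hw : IsWeight w) (p : AddMonoidAlgebra ℂ M) :
    ofFinite hw p = p.coeff.sum fun x c => c • delta hw x := by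
  conv_lhs => rw [← AddMonoidAlgebra.sum_coeff_single p, Finsupp.sum, map_sum]
  refine Finset.sum_congr rfl fun x _ => ?_
  simp only [delta, ← map_smul, AddMonoidAlgebra.smul_single', mul_one]

lemma delta_nsmul (hw : IsWeight w) (k : ℕ) (x : M) : delta hw (k • x) = delta hw x ^ k := by
  induction k with
  | zero => simp [delta_zero]
  | succ k ih => rw [succ_nsmul, delta_add, ih, pow_succ]

/-- The element of the completion with given coefficients (junk if they are not summable). -/
noncomputable def ofCoeffs (hw : IsWeight w) (a : M → ℂ) : WeightedCompletion hw :=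
  ∑' x, a x • delta hw x

lemma norm_smul_delta (hw : IsWeight w) (c : ℂ) (x : M) : ‖c • delta hw x‖ = ‖c‖ * w x := by
  rw [norm_smul, norm_delta]

lemma summable_smul_delta (hw : IsWeight w) {a : M → ℂ} (ha : a ∈ weightedAlgebra w) :
    Summable fun x => a x • delta hw x :=
  Summable.of_norm (by simp only [norm_smul_delta]; exact ha)

lemma hasSum_apply_ofCoeffs (hw : IsWeight w) {a : M → ℂ} (ha : a ∈ weightedAlgebra w)
    (χ : WeakDual.characterSpace ℂ (WeightedCompletion hw)) :
    HasSum (fun x => a x * χ (delta hw x)) (χ (ofCoeffs hw a)) := by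
  have := (WeakDual.CharacterSpace.toCLM χ).hasSum (summable_smul_delta hw ha).hasSum
  simpa [ofCoeffs] using this

/-- Every element of the completion is given by weighted summable coefficients. Both sides of
`∑ x, (T y) x / w x • delta x = y`, with `T` the isometry of the completion into `ℓ¹` that multiplies
coefficients by `w`, are continuous in `y` and agree for finitely supported `y`. -/
lemma exists_eq_ofCoeffs (hw : IsWeight w) (y : WeightedCompletion hw) :
    ∃ c ∈ weightedAlgebra w, y = ofCoeffs hw c := by
  have hone : (1 : ENNReal).toReal = 1 := ENNReal.toReal_one
  have hp : 0 < (1 : ENNReal).toReal := by simp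
  have hsum : ∀ v : lp (fun _ : M => ℂ) 1, HasSum (fun x => ‖v x‖) ‖v‖ := fun v => by
    simpa [hone] using lp.hasSum_norm hp v
  have hterm : ∀ (v : lp (fun _ : M => ℂ) 1) x, ‖(v x / w x) • delta hw x‖ = ‖v x‖ := by
    intro v x
    have := hw.pos x
    rw [norm_smul_delta, norm_div, Complex.norm_real, Real.norm_of_nonneg this.le,
      div_mul_cancel₀ _ this.ne']
  have hS : ∀ v : lp (fun _ : M => ℂ) 1, Summable fun x => (v x / w x) • delta hw x := fun v =>
    Summable.of_norm (by simpa only [hterm] using (hsum v).summable)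
  let S : lp (fun _ : M => ℂ) 1 →L[ℂ] WeightedCompletion hw :=
    LinearMap.mkContinuous
      { toFun := fun v => ∑' x, (v x / w x) • delta hw x
        map_add' := fun u v => by
          rw [← (hS u).tsum_add (hS v)]
          simp [add_div, add_smul]
        map_smul' := fun c v => by
          rw [RingHom.id_apply, ← (hS v).tsum_const_smul]
          simp [mul_div_assoc, mul_smul] } 1 fun v => by
      rw [one_mul]
      refine tsum_of_norm_bounded (hsum v) fun x => (hterm v x).le
  have hmem : ∀ p : AddMonoidAlgebra ℂ M, Memℓp (fun x => p.coeff x * (w x : ℂ)) 1 := fun p => by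
    refine memℓp_gen (summable_of_hasFiniteSupport (p.coeff.hasFiniteSupport.subset fun x hx => ?_))
    rw [Function.mem_support] at hx ⊢
    intro h
    simp [h] at hx
  let T₀ : WeightedMonoidAlgebra hw →L[ℂ] lp (fun _ : M => ℂ) 1 :=
    LinearMap.mkContinuous
      { toFun := fun p => ⟨fun x => AddMonoidAlgebra.coeff p x * (w x : ℂ), hmem p⟩
        map_add' := fun p q => by
          ext x
          exact add_mul _ _ _
        map_smul' := fun c p => by
          ext x
          exact mul_assoc _ _ _ } 1 fun p => by
      have h := weightedNorm_eq_sum (w := w) (Finset.Subset.refl (AddMonoidAlgebra.coeff p).support)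
      rw [one_mul, WeightedMonoidAlgebra.norm_def]
      refine ((hsum _).unique ?_).le
      rw [h]
      have hx : ∀ x, ‖AddMonoidAlgebra.coeff p x * (w x : ℂ)‖ =
          ‖AddMonoidAlgebra.coeff p x‖ * w x := fun x => by
        rw [norm_mul, Complex.norm_real, Real.norm_of_nonneg (hw.pos x).le]
      change HasSum (fun x => ‖AddMonoidAlgebra.coeff p x * (w x : ℂ)‖) _
      rw [funext hx]
      refine hasSum_sum_of_ne_finset_zero fun x hx => ?_
      rw [Finsupp.notMem_support_iff.1 hx, norm_zero, zero_mul]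
  let T : WeightedCompletion hw → lp (fun _ : M => ℂ) 1 := UniformSpace.Completion.extension T₀
  have hTc : Continuous T := UniformSpace.Completion.continuous_extension
  have hST : (fun y => S (T y)) = id := by
    refine (denseRange_ofFinite hw).equalizer (S.continuous.comp hTc) continuous_id ?_
    funext p
    have h1 : T (ofFinite hw p) = T₀ p :=
      UniformSpace.Completion.extension_coe T₀.uniformContinuous p
    have h2 : S (T₀ p) = ∑' x, (p.coeff x * (w x : ℂ) / w x) • delta hw x := rfl
    simp only [Function.comp_apply, id_eq, h1, h2]
    rw [ofFinite_eq_sum, Finsupp.sum, tsum_eq_sum (s := p.coeff.support) fun x hx => by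
      simp [Finsupp.notMem_support_iff.1 hx]]
    refine Finset.sum_congr rfl fun x _ => ?_
    rw [mul_div_cancel_right₀]
    exact_mod_cast (hw.pos x).ne'
  refine ⟨fun x => T y x / w x, ?_, (congrFun hST y).symm⟩
  have := (hsum (T y)).summable
  simp only [← hterm, norm_smul_delta] at this
  exact this

/-- For an admissible weight, `‖χ (delta x)‖ ^ k = ‖χ (delta (k • x))‖ ≤ w (k • x)`, and the root
condition forces `χ` to map the unit masses into the closed unit disc. -/
lemma norm_character_delta_le_one (hw : IsAdmissibleWeight w)
    (χ : WeakDual.characterSpace ℂ (WeightedCompletion hw.toIsWeight)) (x : M) :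
    ‖χ (delta hw.toIsWeight x)‖ ≤ 1 := by
  have hle : ∀ k : ℕ, ‖χ (delta hw.toIsWeight x)‖ ^ k ≤ w (k • x) := fun k => by
    rw [← norm_pow, ← map_pow, ← delta_nsmul]
    have h := spectrum.norm_le_norm_mul_of_mem (𝕜 := ℂ)
      (AlgHom.apply_mem_spectrum χ (delta hw.toIsWeight (k • x)))
    rwa [norm_delta, ← delta_zero, norm_delta, hw.map_zero, mul_one] at h
  refine ge_of_tendsto (hw.tendsto_root x) ?_
  filter_upwards [eventually_ne_atTop 0] with k hk
  rw [one_div, ← Real.pow_rpow_inv_natCast (norm_nonneg (χ (delta hw.toIsWeight x))) hk]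
  exact Real.rpow_le_rpow (by positivity) (hle k) (by positivity)

lemma norm_lift_le_weightedNorm (h1 : ∀ x, 1 ≤ w x) (F : Multiplicative M →* ℂ)
    (hF : ∀ x, ‖F x‖ ≤ 1) (p : AddMonoidAlgebra ℂ M) :
    ‖AddMonoidAlgebra.lift ℂ ℂ M F p‖ ≤ weightedNorm w p := by
  rw [AddMonoidAlgebra.lift_apply]
  refine norm_sum_le_of_le _ fun x _ => ?_
  rw [norm_smul]
  exact mul_le_mul_of_nonneg_left ((hF _).trans (h1 x)) (norm_nonneg _)

/-- The character given by a homomorphism of `M` to the closed unit disc. -/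
lemma exists_character (hw : IsWeight w) (h1 : ∀ x, 1 ≤ w x) (F : Multiplicative M →* ℂ)
    (hF : ∀ x, ‖F x‖ ≤ 1) :
    ∃ χ : WeakDual.characterSpace ℂ (WeightedCompletion hw),
      ∀ p, χ (ofFinite hw p) = AddMonoidAlgebra.lift ℂ ℂ M F p := by
  let E : WeightedMonoidAlgebra hw →ₐ[ℂ] ℂ := AddMonoidAlgebra.lift ℂ ℂ M F
  have hE : Continuous E := by
    refine AddMonoidHomClass.continuous_of_bound E 1 fun p => ?_
    rw [one_mul]
    exact norm_lift_le_weightedNorm h1 F hF p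
  have hcoe : ∀ p : AddMonoidAlgebra ℂ M,
      UniformSpace.Completion.extensionHom (E : WeightedMonoidAlgebra hw →+* ℂ) hE
        (ofFinite hw p) = AddMonoidAlgebra.lift ℂ ℂ M F p := fun p =>
    UniformSpace.Completion.extensionHom_coe (E : WeightedMonoidAlgebra hw →+* ℂ) hE p
  refine ⟨WeakDual.CharacterSpace.equivAlgHom.symm
    { UniformSpace.Completion.extensionHom (E : WeightedMonoidAlgebra hw →+* ℂ) hE with
      commutes' := fun c => ?_ }, fun p => ?_⟩
  · exact (hcoe (algebraMap ℂ _ c)).trans (AlgHom.commutes _ c)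
  · exact hcoe p

end WeightedCompletion

end BanachAlgebra

/-! ### The spectrum of a Dirichlet series -/

section Spectrum

open WeightedCompletion
open scoped NNReal

variable {r : ℕ} {L : AddSubmonoid (Fin r → ℝ)} {w : L → ℝ}

lemma dirichletSeries_eq_tsum (a : L → ℂ) (s : Fin r → ℂ) :
    dirichletSeries a s = ∑' x : L, a x * dirichletChar L s (Multiplicative.ofAdd x) := rfl

lemma norm_dirichletChar_le_one (hL : ∀ x ∈ L, ∀ i, 0 ≤ x i) {s : Fin r → ℂ}
    (hs : s ∈ closedRightHalfSpace r) (x : Multiplicative L) : ‖dirichletChar L s x‖ ≤ 1 := by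
  change ‖Complex.exp _‖ ≤ 1
  rw [Complex.norm_exp, Real.exp_le_one_iff, Complex.neg_re, neg_nonpos, Complex.re_sum]
  refine Finset.sum_nonneg fun i _ => ?_
  rw [Complex.re_ofReal_mul]
  exact mul_nonneg (hL _ x.toAdd.2 i) (hs i)

/-- Evaluation at a point of the closed right half space is a character. -/
lemma exists_evaluation_character (hL : ∀ x ∈ L, ∀ i, 0 ≤ x i) (hw : IsAdmissibleWeight w)
    {s : Fin r → ℂ} (hs : s ∈ closedRightHalfSpace r) :
    ∃ χ : WeakDual.characterSpace ℂ (WeightedCompletion hw.toIsWeight),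
      (∀ p, χ (ofFinite hw.toIsWeight p) = AddMonoidAlgebra.lift ℂ ℂ L (dirichletChar L s) p) ∧
      ∀ a ∈ weightedAlgebra w, χ (ofCoeffs hw.toIsWeight a) = dirichletSeries a s := by
  obtain ⟨χ, hχ⟩ := exists_character hw.toIsWeight hw.one_le (dirichletChar L s)
    (norm_dirichletChar_le_one hL hs)
  refine ⟨χ, hχ, fun a ha => ?_⟩
  rw [← (hasSum_apply_ofCoeffs hw.toIsWeight ha χ).tsum_eq, dirichletSeries_eq_tsum]
  refine tsum_congr fun x => ?_
  rw [delta, hχ, AddMonoidAlgebra.lift_single, one_smul]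

lemma boundaryPoint_mem (t : Fin r → ℝ) : boundaryPoint t ∈ closedRightHalfSpace r :=
  fun i => by simp [boundaryPoint]

/-- The boundary maximum principle for the whole Banach algebra: evaluations at boundary points
dominate all characters. -/
lemma norm_character_le_of_norm_boundary_le (hw : IsAdmissibleWeight w)
    (χt : (Fin r → ℝ) → WeakDual.characterSpace ℂ (WeightedCompletion hw.toIsWeight))
    (hχt : ∀ t p, χt t (ofFinite hw.toIsWeight p) =
      AddMonoidAlgebra.lift ℂ ℂ L (dirichletChar L (boundaryPoint t)) p)
    (y : WeightedCompletion hw.toIsWeight) {C : ℝ} (hC : ∀ t, ‖χt t y‖ ≤ C)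
    (χ : WeakDual.characterSpace ℂ (WeightedCompletion hw.toIsWeight)) : ‖χ y‖ ≤ C := by
  have hnorm : ∀ (ψ : WeakDual.characterSpace ℂ (WeightedCompletion hw.toIsWeight)) v,
      ‖ψ v‖ ≤ ‖v‖ := fun ψ v => by
    have h := spectrum.norm_le_norm_mul_of_mem (𝕜 := ℂ) (AlgHom.apply_mem_spectrum ψ v)
    rwa [← delta_zero, norm_delta, hw.map_zero, mul_one] at h
  refine le_of_forall_pos_le_add fun ε hε => ?_
  obtain ⟨p, hp⟩ := (denseRange_ofFinite hw.toIsWeight).exists_dist_lt y (half_pos hε)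
  rw [dist_eq_norm] at hp
  have hlift : ‖χ (ofFinite hw.toIsWeight p)‖ ≤ C + ε / 2 := by
    -- the homomorphism `x ↦ χ (delta x)` on frequencies
    set F : Multiplicative L →* ℂ := (AddMonoidAlgebra.lift ℂ ℂ L).symm
      ((WeakDual.CharacterSpace.equivAlgHom χ).comp (ofFinite hw.toIsWeight)) with hF
    have h1 : AddMonoidAlgebra.lift ℂ ℂ L F p = χ (ofFinite hw.toIsWeight p) := by
      rw [hF, Equiv.apply_symm_apply]
      rfl
    rw [← h1]
    refine norm_lift_le_of_norm_boundary_le p (fun t => ?_) F fun x =>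
      norm_character_delta_le_one hw χ x.toAdd
    rw [← hχt]
    have h2 := norm_sub_norm_le (χt t (ofFinite hw.toIsWeight p)) (χt t y)
    have h3 := hnorm (χt t) (ofFinite hw.toIsWeight p - y)
    rw [← map_sub] at h2
    rw [norm_sub_rev] at h3
    linarith [hC t]
  have h2 := norm_sub_norm_le (χ y) (χ (ofFinite hw.toIsWeight p))
  rw [← map_sub] at h2
  linarith [hnorm χ (y - ofFinite hw.toIsWeight p)]

/-- The coefficients of `s ↦ ã(s + (σ, …, σ))`. -/
noncomputable def damp (a : L → ℂ) (σ : ℝ≥0) (x : L) : ℂ :=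
  a x * Real.exp (-(σ * ∑ i, (x : Fin r → ℝ) i))

lemma norm_damp_le (hL : ∀ x ∈ L, ∀ i, 0 ≤ x i) (a : L → ℂ) (σ : ℝ≥0) (x : L) :
    ‖damp a σ x‖ ≤ ‖a x‖ := by
  rw [damp, norm_mul, Complex.norm_real, Real.norm_of_nonneg (Real.exp_pos _).le]
  refine mul_le_of_le_one_right (norm_nonneg _) (Real.exp_le_one_iff.2 ?_)
  exact neg_nonpos.2 (mul_nonneg σ.2 (Finset.sum_nonneg fun i _ => hL _ x.2 i))

lemma damp_zero (a : L → ℂ) : damp a 0 = a := by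
  funext x
  simp [damp]

lemma damp_mem (hL : ∀ x ∈ L, ∀ i, 0 ≤ x i) (hw : IsWeight w) {a : L → ℂ}
    (ha : a ∈ weightedAlgebra w) (σ : ℝ≥0) : damp a σ ∈ weightedAlgebra w :=
  Summable.of_nonneg_of_le (fun x => mul_nonneg (norm_nonneg _) (hw.pos x).le)
    (fun x => mul_le_mul_of_nonneg_right (norm_damp_le hL a σ x) (hw.pos x).le) ha

lemma dirichletSeries_damp (a : L → ℂ) (σ : ℝ≥0) (s : Fin r → ℂ) :
    dirichletSeries (damp a σ) s = dirichletSeries a fun i => (σ : ℂ) + s i := by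
  refine tsum_congr fun x => ?_
  rw [damp, mul_assoc, Complex.ofReal_exp, ← Complex.exp_add]
  congr 2
  push_cast
  rw [Finset.mul_sum, ← neg_add, ← Finset.sum_add_distrib]
  congr 1
  exact Finset.sum_congr rfl fun i _ => by ring

lemma norm_damp_smul_delta_le (hL : ∀ x ∈ L, ∀ i, 0 ≤ x i) (hw : IsWeight w) (a : L → ℂ)
    (σ : ℝ≥0) (x : L) : ‖damp a σ x • delta hw x‖ ≤ ‖a x‖ * w x := by
  rw [norm_smul_delta]
  exact mul_le_mul_of_nonneg_right (norm_damp_le hL a σ x) (hw.pos x).le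

lemma continuous_ofCoeffs_damp (hL : ∀ x ∈ L, ∀ i, 0 ≤ x i) (hw : IsWeight w) {a : L → ℂ}
    (ha : a ∈ weightedAlgebra w) : Continuous fun σ => ofCoeffs hw (damp a σ) := by
  refine continuous_tsum (fun x => ?_) ha fun x σ => norm_damp_smul_delta_le hL hw a σ x
  unfold damp
  fun_prop

lemma tendsto_ofCoeffs_damp (hL : ∀ x ∈ L, ∀ i, 0 ≤ x i) (hw : IsWeight w) {a : L → ℂ}
    (ha : a ∈ weightedAlgebra w) :
    Tendsto (fun σ => ofCoeffs hw (damp a σ)) atTop (𝓝 (algebraMap ℂ _ (a 0))) := by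
  classical
  have h0 : algebraMap ℂ (WeightedCompletion hw) (a 0) =
      ∑' x : L, if x = 0 then a x • delta hw x else 0 := by
    rw [tsum_eq_single 0 fun x hx => if_neg hx, if_pos rfl, delta_zero, Algebra.algebraMap_eq_smul_one]
  rw [h0]
  refine tendsto_tsum_of_dominated_convergence (bound := fun x => ‖a x‖ * w x) ha (fun x => ?_)
    (Eventually.of_forall fun σ x => norm_damp_smul_delta_le hL hw a σ x)
  split_ifs with hx
  · subst hx
    simp [damp]
  · have hpos : 0 < ∑ i, (x : Fin r → ℝ) i := by
      refine (Finset.sum_nonneg fun i _ => hL _ x.2 i).lt_of_ne' fun h => hx ?_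
      rw [Finset.sum_eq_zero_iff_of_nonneg fun i _ => hL _ x.2 i] at h
      exact Subtype.ext (funext fun i => h i (Finset.mem_univ i))
    have h1 : Tendsto (fun σ : ℝ≥0 => Real.exp (-((σ : ℝ) * ∑ i, (x : Fin r → ℝ) i))) atTop
        (𝓝 0) :=
      Real.tendsto_exp_neg_atTop_nhds_zero.comp
        ((NNReal.tendsto_coe_atTop.2 tendsto_id).atTop_mul_const hpos)
    have h2 : Tendsto (fun σ => damp a σ x) atTop (𝓝 0) := by
      have := ((Complex.continuous_ofReal.tendsto 0).comp h1).const_mul (a x)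
      simpa [damp, Function.comp_def] using this
    simpa using h2.smul_const (delta hw x)

/-- The spectrum of `a` is contained in the closure of the range of its Dirichlet series on the
open right half space. If `‖ã - z‖ ≥ δ` there, consider the translates `ã(σ + ·)`, `σ > 0`. By the
boundary maximum principle applied to the inverse, `ã(σ + ·) - z` is invertible exactly when all
characters have absolute value at least `δ` on it. The set of such `σ` is thus open and closed in
`(0, ∞)`; it contains all large `σ` because the translates tend to a constant. -/
lemma spectrum_ofCoeffs_subset (hL : ∀ x ∈ L, ∀ i, 0 ≤ x i) (hw : IsAdmissibleWeight w)
    {a : L → ℂ} (ha : a ∈ weightedAlgebra w) :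
    spectrum ℂ (ofCoeffs hw.toIsWeight a) ⊆
      closure (dirichletSeries a '' rightHalfSpace r) := by
  intro z hz
  by_contra hcl
  obtain ⟨δ, hδ, hball⟩ := Metric.isOpen_iff.1 isClosed_closure.isOpen_compl z hcl
  have hlow : ∀ s ∈ rightHalfSpace r, δ ≤ ‖z - dirichletSeries a s‖ := fun s hs => by
    by_contra! hlt
    exact hball (show dirichletSeries a s ∈ Metric.ball z δ by
      rwa [Metric.mem_ball, dist_comm, dist_eq_norm]) (subset_closure ⟨s, hs, rfl⟩)
  choose χt hχt hχt' using fun t : Fin r → ℝ =>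
    exists_evaluation_character hL hw (boundaryPoint_mem t)
  set b : ℝ≥0 → WeightedCompletion hw.toIsWeight := fun σ =>
    algebraMap ℂ _ z - ofCoeffs hw.toIsWeight (damp a σ) with hb
  have hbc : Continuous b :=
    continuous_const.sub (continuous_ofCoeffs_damp hL hw.toIsWeight ha)
  have hbt : ∀ σ, 0 < σ → ∀ t, δ ≤ ‖χt t (b σ)‖ := fun σ hσ t => by
    rw [hb, map_sub, AlgHomClass.commutes, hχt' t _ (damp_mem hL hw.toIsWeight ha σ),
      dirichletSeries_damp]
    refine hlow _ fun i => ?_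
    simpa [boundaryPoint] using hσ
  set U : Set ℝ≥0 := {σ | IsUnit (b σ)} ∩ Set.Ioi 0 with hU
  set V : Set ℝ≥0 := {σ | ∀ χ : WeakDual.characterSpace ℂ (WeightedCompletion hw.toIsWeight),
    δ ≤ ‖χ (b σ)‖} with hV
  have hχc : ∀ χ : WeakDual.characterSpace ℂ (WeightedCompletion hw.toIsWeight),
      Continuous fun σ => χ (b σ) := fun χ => (WeakDual.CharacterSpace.toCLM χ).continuous.comp hbc
  have hUo : IsOpen U := (Units.isOpen.preimage hbc).inter isOpen_Ioi
  have hVc : IsClosed V := by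
    rw [hV, Set.ofPred_forall]
    exact isClosed_iInter fun χ => isClosed_le continuous_const (hχc χ).norm
  have hunit : ∀ σ ∈ V, IsUnit (b σ) := fun σ hσ => by
    by_contra h
    obtain ⟨χ, hχ⟩ := WeakDual.CharacterSpace.exists_apply_eq_zero h
    have := hσ χ
    rw [hχ, norm_zero] at this
    exact hδ.not_ge this
  -- the boundary bound for `b σ` is only available for `σ > 0`, where the arguments stay in `ℍ^r`
  have hUV : U ⊆ V := by
    rintro σ ⟨hσ, hσ0⟩ χ
    obtain ⟨y, hy⟩ := hσ.exists_right_inv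
    have hinv : ∀ ψ : WeakDual.characterSpace ℂ (WeightedCompletion hw.toIsWeight),
        ‖ψ (b σ)‖ * ‖ψ y‖ = 1 := fun ψ => by
      rw [← norm_mul, ← map_mul, hy, map_one, norm_one]
    have hle : ‖χ y‖ ≤ δ⁻¹ := by
      refine norm_character_le_of_norm_boundary_le hw χt hχt y (fun t => ?_) χ
      rw [eq_inv_of_mul_eq_one_right (hinv (χt t))]
      exact inv_anti₀ hδ (hbt σ hσ0 t)
    have h1 := hinv χ
    have h2 : 0 < ‖χ y‖ := (norm_nonneg _).lt_of_ne fun h => by simp [← h] at h1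
    rw [eq_inv_of_mul_eq_one_left h1]
    exact (le_inv_comm₀ h2 hδ).1 hle
  have hlim : Tendsto b atTop (𝓝 (algebraMap ℂ _ (z - a 0))) := by
    rw [map_sub]
    exact (tendsto_ofCoeffs_damp hL hw.toIsWeight ha).const_sub _
  have hne : z - a 0 ≠ 0 := by
    have h1 := ((WeakDual.CharacterSpace.toCLM (χt 0)).continuous.tendsto _).comp hlim
    have h2 := ge_of_tendsto h1.norm ((eventually_gt_atTop 0).mono fun σ hσ => hbt σ hσ 0)
    have h3 : χt 0 (algebraMap ℂ _ (z - a 0)) = z - a 0 := AlgHomClass.commutes _ _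
    intro h
    change δ ≤ ‖χt 0 (algebraMap ℂ _ (z - a 0))‖ at h2
    rw [h3, h, norm_zero] at h2
    exact hδ.not_ge h2
  have hUne : (Set.Ioi 0 ∩ U).Nonempty := by
    have hu : IsUnit (algebraMap ℂ (WeightedCompletion hw.toIsWeight) (z - a 0)) :=
      (IsUnit.mk0 _ hne).map _
    obtain ⟨σ, h1, h2⟩ :=
      ((hlim.eventually (Units.isOpen.mem_nhds hu)).and (eventually_gt_atTop 0)).exists
    exact ⟨σ, h2, h1, h2⟩
  have hsub : Set.Ioi 0 ⊆ U :=
    isPreconnected_Ioi.subset_left_of_subset_union hUo hVc.isOpen_compl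
      (Set.disjoint_compl_right_iff_subset.2 hUV)
      (fun σ hσ => (em (σ ∈ V)).imp (fun h => ⟨hunit σ h, hσ⟩) id) hUne
  have h0 : (0 : ℝ≥0) ∈ V := by
    have := hVc.closure_subset_iff.2 (hsub.trans hUV)
    rw [closure_Ioi] at this
    exact this (Set.mem_Ici.2 le_rfl)
  have h1 := hunit 0 h0
  simp only [hb, damp_zero] at h1
  exact spectrum.mem_iff.1 hz h1

end Spectrum

theorem theorem5 (r : ℕ) (L : AddSubmonoid (Fin r → ℝ))
    (hL : ∀ x ∈ L, ∀ i, 0 ≤ x i)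
    (w : L → ℝ) (hw : IsAdmissibleWeight w)
    (G : Set ℂ) (hG : IsOpen G) (hGc : IsConnected G)
    (f : ℂ → ℂ) (hf : DifferentiableOn ℂ f G)
    (a : L → ℂ) (ha : a ∈ weightedAlgebra w)
    (haG : closure (dirichletSeries a '' rightHalfSpace r) ⊆ G) :
    ∃ c ∈ weightedAlgebra w,
      Set.EqOn (f ∘ dirichletSeries a) (dirichletSeries c) (closedRightHalfSpace r) := by
  obtain ⟨y, hy⟩ := exists_forall_character_eq_comp
    (WeightedCompletion.ofCoeffs hw.toIsWeight a) hG hf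
    ((spectrum_ofCoeffs_subset hL hw ha).trans haG)
  obtain ⟨c, hc, rfl⟩ := WeightedCompletion.exists_eq_ofCoeffs hw.toIsWeight y
  refine ⟨c, hc, fun s hs => ?_⟩
  obtain ⟨χ, -, hχ⟩ := exists_evaluation_character hL hw hs
  rw [Function.comp_apply, ← hχ a ha, ← hχ c hc, hy]
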